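/- **Airline pricing: quantum versus classical and correlated equilibrium.** Two firms independently receive a signal, $N$ or $P$, each with probability $1/2$; each firm sees only its own signal and then announces the price $L$ or $H$. With rows for Firm One and columns for Firm Two (in the order $L,H$), the payoffs are $$\begin{pmatrix}(A,A)&(B,0)\\(0,B)&(0,0)\end{pmatrix}\ \text{if both signals are } N,\qquad \begin{pmatrix}(C,C)&(B,0)\\(0,B)&(D,D)\end{pmatrix}\ \text{otherwise},$$ where $A=1$, $B=50$, $C=20$, $D=60$. Call this game of private information $G$, and let $G^\#$ be the $4\times 4$ game in which a strategy is a map $\{N,P\}\to\{L,H\}$ and payoffs are averaged over the signals. *Quantum game.* Identify $L,H$ with the orientations heads ($\mathbf H$) and tails ($\mathbf T$) of a coin; the firms hold a pair of coins in the state $\xi=\mathbf{HH}+\mathbf{TT}\in\mathbb C^2\otimes\mathbb C^2$. A quantum strategy is either a unitary $2\times2$ matrix or a pure strategy ($L$ or $H$). If the firms use unitaries $U,V$, the pair of announced prices is distributed proportionally to the squared moduli of the coordinates of $(U\otimes V)\xi$. If only one firm uses a unitary, it observes its own coin, whose orientation has its marginal law in the resulting state, while the other firm plays its pure strategy. In $G(\xi)^\#$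 a strategy is a map from the firm's own signals $\{N,P\}$ to quantum strategies, and payoffs are expected payoffs; $G(\xi)^\#_0$ is the subgame in which only unitaries are allowed. Let $$M(\theta)=\begin{pmatrix}\cos\theta&\sin\theta\\-\sin\theta&\cos\theta\end{pmatrix},$$ and let the rotation profile with angle $\theta$ be: Firm One uses $M(-\theta)$ after $N$ and $M(\theta)$ after $P$; Firm Two uses $M(2\theta)$ after $N$ and $M(0)$ after $P$. Then: 1. The only classical equilibrium, both in behavioral strategies (independent randomization after each signal) and in mixed strategies of $G^\#$, is "both firms always play $L$". Each firm's expected payoff is $15.25$. 2. The only correlated equilibrium of $G^\#$ (in the sense of Aumann) is the point mass on "both firms always play $L$", with expected payoff $15.25$ to each firm. 3. Let $\theta=\arccos\left(\tfrac12\sqrt{\tfrac{14+\sqrt{79}}{7}}\right)$. This angle maximizes both firms' payoffs among all rotation profiles. The rotation profile with angle $\theta$ is a Pareto optimal Nash equilibrium of $G(\xi)^\#_0$, and it is a Nash equilibrium of the full quantum game $G(\xi)^\#$, with payoff $$\frac{3087+79\sqrt{79}}{112}\approx 33.83$$ to each firm. 4. Consequently the outcome of this quantum equilibrium is Pareto superior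 to the outcome of every correlated equilibrium of $G^\#$. -/

import Mathlib

noncomputable section

namespace QuantumGames

open scoped Kronecker

/-! Two-player games. -/

/-- A two-player game with strategy sets `S₁`, `S₂` and payoff functions `P₁`, `P₂`. -/
structure TwoPlayerGame (S₁ S₂ : Type) where
  P₁ : S₁ → S₂ → ℝ
  P₂ : S₁ → S₂ → ℝ

namespace TwoPlayerGame

variable {S₁ S₂ : Type}

/-- The pair of payoffs at a strategy profile. -/
def payoff (G : TwoPlayerGame S₁ S₂) (s : S₁) (t : S₂) : ℝ × ℝ := (G.P₁ s t, G.P₂ s t)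

/-- Nash equilibrium: no player gains by a unilateral deviation. -/
def IsNash (G : TwoPlayerGame S₁ S₂) (s : S₁) (t : S₂) : Prop :=
  (∀ s', G.P₁ s' t ≤ G.P₁ s t) ∧ (∀ t', G.P₂ s t' ≤ G.P₂ s t)

/-- The game of mixed strategies: each player independently picks a probability distribution
on his strategy set, and payoffs are expected payoffs. -/
def mixed [Fintype S₁] [Fintype S₂] (G : TwoPlayerGame S₁ S₂) :
    TwoPlayerGame (stdSimplex ℝ S₁) (stdSimplex ℝ S₂) where
  P₁ σ τ := ∑ s, ∑ t, σ s * τ t * G.P₁ s t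
  P₂ σ τ := ∑ s, ∑ t, σ s * τ t * G.P₂ s t

/-- The pair of expected payoffs under a joint distribution of the two strategies. -/
def expPayoff [Fintype S₁] [Fintype S₂] (G : TwoPlayerGame S₁ S₂)
    (μ : stdSimplex ℝ (S₁ × S₂)) : ℝ × ℝ :=
  (∑ x, μ x * G.P₁ x.1 x.2, ∑ x, μ x * G.P₂ x.1 x.2)

/-- Correlated equilibrium in the sense of Aumann: `μ` is the joint law of the recommended
strategies, and no player gains by playing a function of his own recommendation instead. -/
def IsCorrelatedEq [Fintype S₁] [Fintype S₂] (G : TwoPlayerGame S₁ S₂)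
    (μ : stdSimplex ℝ (S₁ × S₂)) : Prop :=
  (∀ f : S₁ → S₁, ∑ x, μ x * G.P₁ (f x.1) x.2 ≤ ∑ x, μ x * G.P₁ x.1 x.2) ∧
  (∀ g : S₂ → S₂, ∑ x, μ x * G.P₂ x.1 (g x.2) ≤ ∑ x, μ x * G.P₂ x.1 x.2)

end TwoPlayerGame

/-- The payoff pair `u` is Pareto superior to `v`: nobody is worse off, somebody is better off. -/
def ParetoSuperior (u v : ℝ × ℝ) : Prop :=
  v.1 ≤ u.1 ∧ v.2 ≤ u.2 ∧ (v.1 < u.1 ∨ v.2 < u.2)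

/-- A strategy profile is Pareto optimal if no profile of the game is Pareto superior to it. -/
def TwoPlayerGame.IsParetoOptimal {S₁ S₂ : Type} (G : TwoPlayerGame S₁ S₂)
    (s : S₁) (t : S₂) : Prop :=
  ¬ ∃ s' t', ParetoSuperior (G.payoff s' t') (G.payoff s t)

/-! Games of private information. -/

/-- A two-player game of private information with finite signal sets `A₁`, `A₂`, strategy sets
`S₁`, `S₂`, a distribution `ν` of signal pairs and signal-dependent payoffs. -/
structure PrivateInfoGame (A₁ A₂ S₁ S₂ : Type) [Fintype A₁] [Fintype A₂] where
  ν : stdSimplex ℝ (A₁ × A₂)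
  P₁ : A₁ → A₂ → S₁ → S₂ → ℝ
  P₂ : A₁ → A₂ → S₁ → S₂ → ℝ

namespace PrivateInfoGame

variable {A₁ A₂ S₁ S₂ : Type} [Fintype A₁] [Fintype A₂]

/-- The associated game `G^#` of contingent strategies: a strategy is a map from the player's own
signals to strategies, and payoffs are averaged over the signal pair. -/
def sharp (G : PrivateInfoGame A₁ A₂ S₁ S₂) : TwoPlayerGame (A₁ → S₁) (A₂ → S₂) where
  P₁ F₁ F₂ := ∑ a, ∑ b, G.ν (a, b) * G.P₁ a b (F₁ a) (F₂ b)
  P₂ F₁ F₂ := ∑ a, ∑ b, G.ν (a, b) * G.P₂ a b (F₁ a) (F₂ b)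

/-- The game of private information in which the strategies are (independent) probability
distributions on the original strategy sets. Contingent strategies in it are the classical
behavioral strategies of the original game. -/
def mixed [Fintype S₁] [Fintype S₂] (G : PrivateInfoGame A₁ A₂ S₁ S₂) :
    PrivateInfoGame A₁ A₂ (stdSimplex ℝ S₁) (stdSimplex ℝ S₂) where
  ν := G.ν
  P₁ a b σ τ := ∑ s, ∑ t, σ s * τ t * G.P₁ a b s t
  P₂ a b σ τ := ∑ s, ∑ t, σ s * τ t * G.P₂ a b s t

end PrivateInfoGame

/-! Quantum environments for games in which both players have two strategies. -/

/-- The two strategies, which are also the two orientations of a coin: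
`0` is heads and `1` is tails. -/
abbrev Face : Type := Fin 2

/-- A (not necessarily normalized) state of a pair of coins is a vector with coordinates on the
basis `HH, HT, TH, TT`; a quantum environment is a nonzero one. -/
abbrev Environment : Type := {ξ : Face × Face → ℂ // ξ ≠ 0}

/-- The environment `HH + TT`. -/
def maximallyEntangled : Environment :=
  ⟨fun x => if x.1 = x.2 then 1 else 0, fun h => by simpa using congrFun h (0, 0)⟩

/-- A quantum strategy: apply a unitary operator to one's coin and play its observed orientation,
or discard the coin and play a pure strategy. -/
inductive QStrategy : Type
  | unitary (U : Matrix.unitaryGroup Face ℂ)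
  | pure (s : Face)

/-- The state `(U ⊗ V) ξ` that results when the players apply `U` and `V` to their own coins. -/
def evolve (ξ : Face × Face → ℂ) (U V : Matrix Face Face ℂ) : Face × Face → ℂ :=
  (U ⊗ₖ V).mulVec ξ

/-- The probabilities of the outcomes of observing both coins: they are proportional to the
squared moduli of the coordinates. -/
def observe (ψ : Face × Face → ℂ) (x : Face × Face) : ℝ :=
  ‖ψ x‖ ^ 2 / ∑ y, ‖ψ y‖ ^ 2

/-- The distribution of the pair of played strategies. A player whose opponent discards his coin
still observes his own coin; its law is the marginal law of that coin. -/
def playLaw (ξ : Face × Face → ℂ) : QStrategy → QStrategy → Face × Face → ℝ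
  | .unitary U, .unitary V => observe (evolve ξ U.1 V.1)
  | .unitary U, .pure t => fun x =>
      if x.2 = t then ∑ j, observe (evolve ξ U.1 1) (x.1, j) else 0
  | .pure s, .unitary V => fun x =>
      if x.1 = s then ∑ i, observe (evolve ξ 1 V.1) (i, x.2) else 0
  | .pure s, .pure t => fun x => if x = (s, t) then 1 else 0

namespace PrivateInfoGame

variable {A₁ A₂ : Type} [Fintype A₁] [Fintype A₂]

/-- The game of private information `G(ξ)`. -/
def quantum (G : PrivateInfoGame A₁ A₂ Face Face) (ξ : Environment) :
    PrivateInfoGame A₁ A₂ QStrategy QStrategy where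
  ν := G.ν
  P₁ a b X Y := ∑ x, playLaw ξ.1 X Y x * G.P₁ a b x.1 x.2
  P₂ a b X Y := ∑ x, playLaw ξ.1 X Y x * G.P₂ a b x.1 x.2

/-- The restriction of `G(ξ)` in which pure strategies are not allowed. -/
def quantumOnly (G : PrivateInfoGame A₁ A₂ Face Face) (ξ : Environment) :
    PrivateInfoGame A₁ A₂ (Matrix.unitaryGroup Face ℂ) (Matrix.unitaryGroup Face ℂ) where
  ν := G.ν
  P₁ a b U V := (G.quantum ξ).P₁ a b (.unitary U) (.unitary V)
  P₂ a b U V := (G.quantum ξ).P₂ a b (.unitary U) (.unitary V)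

end PrivateInfoGame

/-- The rotation `M(θ)`. -/
def rotation (θ : ℝ) : Matrix.unitaryGroup Face ℂ :=
  ⟨!![(Real.cos θ : ℂ), (Real.sin θ : ℂ); -(Real.sin θ : ℂ), (Real.cos θ : ℂ)], by
    have h : ∀ c s : ℝ, c ^ 2 + s ^ 2 = 1 →
        !![(c : ℂ), (s : ℂ); -(s : ℂ), (c : ℂ)] ∈ Matrix.unitaryGroup Face ℂ := by
      intro c s hcs
      have hc : (c : ℂ) ^ 2 + (s : ℂ) ^ 2 = 1 := by exact_mod_cast hcs
      rw [Matrix.mem_unitaryGroup_iff]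
      ext i j
      fin_cases i <;> fin_cases j <;>
        simp [Matrix.mul_apply, Fin.sum_univ_two, Matrix.star_apply] <;>
        first | ring1 | linear_combination hc
    exact h _ _ (Real.cos_sq_add_sin_sq θ)⟩

/-! The airline pricing game. -/

/-- A firm's signal about demand: `0` is the negative signal `N`, `1` the positive signal `P`. -/
abbrev Signal : Type := Fin 2

/-- "Announce the low price" (heads). -/
def low : Face := 0

/-- The two signals are independent, each equally likely to be `N` or `P`. -/
def fairSignals : stdSimplex ℝ (Signal × Signal) :=
  ⟨fun _ => 1 / 4, fun _ => by norm_num, by simp⟩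

/-- The airline pricing game. In the matrices the row is the price announced by firm one, the
column the price announced by firm two, and the low price comes first. -/
def airline (A B C D : ℝ) : PrivateInfoGame Signal Signal Face Face where
  ν := fairSignals
  P₁ a b := if a = 0 ∧ b = 0 then !![A, B; 0, 0] else !![C, B; 0, D]
  P₂ a b := if a = 0 ∧ b = 0 then !![A, 0; B, 0] else !![C, 0; B, D]

/-- The contingent strategy "play `L` whatever the signal". -/
def alwaysLow : Signal → Face := fun _ => low

/-- The behavioral strategy "play `L` with probability one whatever the signal". -/
def alwaysLowBehavioral : Signal → stdSimplex ℝ Face := fun _ => stdSimplex.vertex low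

/-- Firm one's part of the rotation profile: `M(-θ)` after `N` and `M(θ)` after `P`. -/
def rotation₁ (θ : ℝ) : Signal → Matrix.unitaryGroup Face ℂ := ![rotation (-θ), rotation θ]

/-- Firm two's part of the rotation profile: `M(2θ)` after `N` and `M(0)` after `P`. -/
def rotation₂ (θ : ℝ) : Signal → Matrix.unitaryGroup Face ℂ := ![rotation (2 * θ), rotation 0]

end QuantumGames

end

open QuantumGames

namespace QuantumGames

/-! General facts about correlated and mixed equilibria. -/

namespace TwoPlayerGame

variable {S₁ S₂ : Type} [Fintype S₁] [Fintype S₂]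

/-! Classical side: iterated elimination of strictly dominated strategies in the 4×4 game leaves
only "always low", and no correlated equilibrium puts mass on an eliminated strategy
(`correlatedEq_eq_vertex`). A mixed equilibrium induces a product law that is a correlated
equilibrium, so it is unique too. Behavioral equilibria are settled separately, by a sign analysis
of two linear gains per firm.

Quantum side: the amplitudes of `(U ⊗ V) ξ` are the entries of the unitary matrix `U Vᵀ`, so the law
of the prices depends on the single number `|(U Vᵀ) 0 0|²`, and both firms receive the same payoff.
With unitaries alone this is a common-interest game, where a global maximum is automatically a Nash
equilibrium and Pareto optimal. Writing the agreement as `(1 + a ⬝ b) / 2` with unit Bloch vectors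
turns the maximization into a weighted CHSH problem, solved by a sum of squares
(`weighted_tsirelson`); the rotation profile attains the bound.

Discarding the coin gives nothing more: each coin alone is fair, so a pure price earns an amount
independent of the opponent's unitary, and signal by signal this is below the equilibrium amount. -/

theorem sum_vertex_mul {ι : Type} [Fintype ι] [DecidableEq ι] (i : ι) (F : ι → ℝ) :
    ∑ x, (stdSimplex.vertex i : stdSimplex ℝ ι) x * F x = F i := by
  rw [Finset.sum_eq_single i]
  · simp [stdSimplex.vertex]
  · intro b _ hb
    simp [stdSimplex.vertex, hb]
  · simp

theorem mixed_P₁_eq (G : TwoPlayerGame S₁ S₂) (σ : stdSimplex ℝ S₁) (τ : stdSimplex ℝ S₂) :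
    G.mixed.P₁ σ τ = ∑ s, σ s * ∑ t, τ t * G.P₁ s t := by
  simp [mixed, Finset.mul_sum, mul_assoc]

theorem mixed_P₂_eq (G : TwoPlayerGame S₁ S₂) (σ : stdSimplex ℝ S₁) (τ : stdSimplex ℝ S₂) :
    G.mixed.P₂ σ τ = ∑ t, τ t * ∑ s, σ s * G.P₂ s t := by
  simp only [mixed, Finset.mul_sum]
  rw [Finset.sum_comm]
  exact Finset.sum_congr rfl fun _ _ => Finset.sum_congr rfl fun _ _ => by ring

theorem sum_mul_le_of_le {ι : Type} [Fintype ι] (σ : stdSimplex ℝ ι) (F : ι → ℝ) (c : ℝ)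
    (h : ∀ i, F i ≤ c) : ∑ i, σ i * F i ≤ c := by
  calc ∑ i, σ i * F i ≤ ∑ i, σ i * c :=
        Finset.sum_le_sum fun i _ => mul_le_mul_of_nonneg_left (h i) (σ.2.1 i)
    _ = c := by
        have : ∑ i, σ i = 1 := σ.2.2
        rw [← Finset.sum_mul, this, one_mul]

theorem isCorrelatedEq_vertex [DecidableEq S₁] [DecidableEq S₂] {G : TwoPlayerGame S₁ S₂}
    {s : S₁} {t : S₂} (h : G.IsNash s t) : G.IsCorrelatedEq (stdSimplex.vertex (s, t)) := by
  constructor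
  · intro f
    rw [sum_vertex_mul (s, t) (fun x : S₁ × S₂ => G.P₁ (f x.1) x.2),
      sum_vertex_mul (s, t) (fun x : S₁ × S₂ => G.P₁ x.1 x.2)]
    exact h.1 _
  · intro f
    rw [sum_vertex_mul (s, t) (fun x : S₁ × S₂ => G.P₂ x.1 (f x.2)),
      sum_vertex_mul (s, t) (fun x : S₁ × S₂ => G.P₂ x.1 x.2)]
    exact h.2 _

theorem mixed_isNash_vertex [DecidableEq S₁] [DecidableEq S₂] {G : TwoPlayerGame S₁ S₂}
    {s : S₁} {t : S₂} (h : G.IsNash s t) :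
    G.mixed.IsNash (stdSimplex.vertex s) (stdSimplex.vertex t) := by
  constructor
  · intro σ
    simp only [mixed_P₁_eq, sum_vertex_mul]
    exact sum_mul_le_of_le σ _ _ h.1
  · intro τ
    simp only [mixed_P₂_eq, sum_vertex_mul]
    exact sum_mul_le_of_le τ _ _ h.2

/-- The joint law of independent mixed strategies. -/
def independent (σ : stdSimplex ℝ S₁) (τ : stdSimplex ℝ S₂) : stdSimplex ℝ (S₁ × S₂) :=
  ⟨fun x => σ x.1 * τ x.2, fun x => mul_nonneg (σ.2.1 _) (τ.2.1 _), by
    have h₁ : ∑ i, σ i = 1 := σ.2.2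
    have h₂ : ∑ i, τ i = 1 := τ.2.2
    rw [Fintype.sum_prod_type, ← Finset.sum_mul_sum, h₁, h₂, one_mul]⟩

@[simp] theorem independent_apply (σ : stdSimplex ℝ S₁) (τ : stdSimplex ℝ S₂) (x : S₁ × S₂) :
    independent σ τ x = σ x.1 * τ x.2 := rfl

/-- Under independence a recommendation says nothing about the opponent's play, so the reply to each
recommendation earns at most the equilibrium payoff, and so does their average. -/
theorem IsNash.isCorrelatedEq_independent {G : TwoPlayerGame S₁ S₂} {σ : stdSimplex ℝ S₁}
    {τ : stdSimplex ℝ S₂} (h : G.mixed.IsNash σ τ) : G.IsCorrelatedEq (independent σ τ) := by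
  classical
  constructor
  · intro f
    have e : ∀ g : S₁ → S₁, ∑ x, independent σ τ x * G.P₁ (g x.1) x.2 =
        ∑ s, σ s * ∑ t, τ t * G.P₁ (g s) t := by
      intro g
      simp [Fintype.sum_prod_type, Finset.mul_sum, mul_assoc]
    refine (e f).trans_le (le_of_le_of_eq (sum_mul_le_of_le σ _ _ fun s => ?_) (e id).symm)
    have := h.1 (stdSimplex.vertex (f s))
    simpa only [mixed_P₁_eq, sum_vertex_mul, id] using this
  · intro f
    have e : ∀ g : S₂ → S₂, ∑ x, independent σ τ x * G.P₂ x.1 (g x.2) =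
        ∑ t, τ t * ∑ s, σ s * G.P₂ s (g t) := by
      intro g
      rw [Fintype.sum_prod_type, Finset.sum_comm]
      simp only [Finset.mul_sum, independent_apply]
      exact Finset.sum_congr rfl fun _ _ => Finset.sum_congr rfl fun _ _ => by ring
    refine (e f).trans_le (le_of_le_of_eq (sum_mul_le_of_le τ _ _ fun s => ?_) (e id).symm)
    have := h.2 (stdSimplex.vertex (f s))
    simpa only [mixed_P₂_eq, sum_vertex_mul, id] using this

/-- In a correlated equilibrium, no recommendation can be profitably replaced. -/
theorem IsCorrelatedEq.sum_gain₁_le {G : TwoPlayerGame S₁ S₂} {μ : stdSimplex ℝ (S₁ × S₂)}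
    (h : G.IsCorrelatedEq μ) (s s' : S₁) :
    ∑ t, μ (s, t) * (G.P₁ s' t - G.P₁ s t) ≤ 0 := by
  classical
  -- Disobeying only the recommendation `s` makes every other row cancel.
  have := h.1 (Function.update id s s')
  rw [← sub_nonpos, ← Finset.sum_sub_distrib, Fintype.sum_prod_type,
    Finset.sum_eq_single s] at this
  · simpa [mul_sub] using this
  · intro b _ hb
    simp [hb]
  · simp

theorem IsCorrelatedEq.sum_gain₂_le {G : TwoPlayerGame S₁ S₂} {μ : stdSimplex ℝ (S₁ × S₂)}
    (h : G.IsCorrelatedEq μ) (t t' : S₂) :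
    ∑ s, μ (s, t) * (G.P₂ s t' - G.P₂ s t) ≤ 0 := by
  classical
  have := h.2 (Function.update id t t')
  rw [← sub_nonpos, ← Finset.sum_sub_distrib, Fintype.sum_prod_type_right,
    Finset.sum_eq_single t] at this
  · simpa [mul_sub] using this
  · intro b _ hb
    simp [hb]
  · simp

end TwoPlayerGame

theorem eq_vertex_of_apply_eq_one {ι : Type} [Fintype ι] [DecidableEq ι] {σ : stdSimplex ℝ ι}
    {i : ι} (h : σ i = 1) : σ = stdSimplex.vertex i := by
  have hs : ∑ j, σ j = 1 := σ.2.2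
  rw [← Finset.add_sum_erase _ _ (Finset.mem_univ i), h] at hs
  have h0 := (Finset.sum_eq_zero_iff_of_nonneg (f := fun j => σ j)
    (s := Finset.univ.erase i) (fun j _ => σ.2.1 j)).1 (by linarith)
  ext j
  by_cases hj : j = i
  · subst hj
    simp [stdSimplex.vertex, h]
  · simpa [stdSimplex.vertex, hj] using h0 j (by simp [hj])

/-! The classical airline game. -/

theorem sum_contingent {M : Type} [AddCommMonoid M] (F : (Fin 2 → Fin 2) → M) :
    ∑ f, F f = F ![0, 0] + F ![0, 1] + (F ![1, 0] + F ![1, 1]) := by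
  rw [← (finTwoArrowEquiv (Fin 2)).symm.sum_comp, Fintype.sum_prod_type]
  simp [Fin.sum_univ_two]

theorem fairSignals_apply (x : Signal × Signal) : fairSignals x = 1 / 4 := rfl

theorem airline_sharp_P₁ (A B C D : ℝ) (f g : Signal → Face) :
    (airline A B C D).sharp.P₁ f g = (!![A, B; 0, 0] (f 0) (g 0) + !![C, B; 0, D] (f 0) (g 1) +
      !![C, B; 0, D] (f 1) (g 0) + !![C, B; 0, D] (f 1) (g 1)) / 4 := by
  simp [PrivateInfoGame.sharp, airline, Fin.sum_univ_two, fairSignals_apply]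
  ring

theorem airline_sharp_P₂ (A B C D : ℝ) (f g : Signal → Face) :
    (airline A B C D).sharp.P₂ f g = (airline A B C D).sharp.P₁ g f := by
  rw [airline_sharp_P₁]
  have h : ∀ A B D : ℝ, ∀ i j : Fin 2, !![A, 0; B, D] i j = !![A, B; 0, D] j i := by
    intro A B D i j
    fin_cases i <;> fin_cases j <;> rfl
  simp [PrivateInfoGame.sharp, airline, Fin.sum_univ_two, fairSignals_apply, h]
  ring

theorem airline_sharp_isNash :
    (airline 1 50 20 60).sharp.IsNash alwaysLow alwaysLow := by
  have h : ∀ f, (airline 1 50 20 60).sharp.P₁ f alwaysLow ≤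
      (airline 1 50 20 60).sharp.P₁ alwaysLow alwaysLow := by
    intro f
    simp only [airline_sharp_P₁, alwaysLow, low]
    generalize f 0 = i, f 1 = j
    fin_cases i <;> fin_cases j <;> norm_num
  exact ⟨h, fun g => by simpa only [airline_sharp_P₂] using h g⟩

theorem airline_sharp_P₁_alwaysLow :
    (airline 1 50 20 60).sharp.P₁ alwaysLow alwaysLow = 15.25 := by
  norm_num [airline_sharp_P₁, alwaysLow, low]

theorem alwaysLow_eq : alwaysLow = ![0, 0] := by
  ext i; fin_cases i <;> rfl

/-- Iterated strict dominance, run on the incentive inequalities. `![x, y]` means price `x` after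
`N` and `y` after `P`; the strategies `![1, 1]`, `![0, 1]`, `![1, 0]` lose their mass in this order.
-/
theorem correlatedEq_eq_vertex {μ : stdSimplex ℝ ((Signal → Face) × (Signal → Face))}
    (h : (airline 1 50 20 60).sharp.IsCorrelatedEq μ) :
    μ = stdSimplex.vertex (alwaysLow, alwaysLow) := by
  have h₁ := h.sum_gain₁_le
  have h₂ := h.sum_gain₂_le
  have hn : ∀ x, 0 ≤ μ x := fun x => μ.2.1 x
  have hs : ∑ x, μ x = 1 := μ.2.2
  apply eq_vertex_of_apply_eq_one
  rw [alwaysLow_eq]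
  rw [Fintype.sum_prod_type] at hs
  simp only [sum_contingent] at hs
  simp only [airline_sharp_P₂, airline_sharp_P₁, sum_contingent] at h₁ h₂
  have a₁ := h₁ ![1, 1] ![0, 1]
  have a₂ := h₁ ![1, 1] ![1, 0]
  have a₃ := h₁ ![0, 1] ![0, 0]
  have a₄ := h₁ ![1, 0] ![0, 0]
  have b₁ := h₂ ![1, 1] ![0, 1]
  have b₂ := h₂ ![1, 1] ![1, 0]
  have b₃ := h₂ ![0, 1] ![0, 0]
  have b₄ := h₂ ![1, 0] ![0, 0]
  clear h₁ h₂
  norm_num at a₁ a₂ a₃ a₄ b₁ b₂ b₃ b₄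
  have n₀₁ := hn (![0, 0], ![0, 1])
  have n₀₂ := hn (![0, 0], ![1, 0])
  have n₀₃ := hn (![0, 0], ![1, 1])
  have n₁₀ := hn (![0, 1], ![0, 0])
  have n₁₁ := hn (![0, 1], ![0, 1])
  have n₁₂ := hn (![0, 1], ![1, 0])
  have n₁₃ := hn (![0, 1], ![1, 1])
  have n₂₀ := hn (![1, 0], ![0, 0])
  have n₂₁ := hn (![1, 0], ![0, 1])
  have n₂₂ := hn (![1, 0], ![1, 0])
  have n₂₃ := hn (![1, 0], ![1, 1])
  have n₃₀ := hn (![1, 1], ![0, 0])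
  have n₃₁ := hn (![1, 1], ![0, 1])
  have n₃₂ := hn (![1, 1], ![1, 0])
  have n₃₃ := hn (![1, 1], ![1, 1])
  -- The gains in `a₁` and `a₂` add up to a positive number in every column: the even mixture of
  -- `![0, 1]` and `![1, 0]` strictly dominates `![1, 1]`, though neither does alone.
  have hh : μ (![1, 1], ![0, 0]) + μ (![1, 1], ![0, 1]) + μ (![1, 1], ![1, 0])
      + μ (![1, 1], ![1, 1]) ≤ 0 := by linarith
  have hh' : μ (![0, 0], ![1, 1]) + μ (![0, 1], ![1, 1]) + μ (![1, 0], ![1, 1])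
      + μ (![1, 1], ![1, 1]) ≤ 0 := by linarith
  -- Moving from `![0, 1]` to `![0, 0]` loses only against `![1, 1]`, which is already excluded.
  have lh : μ (![0, 1], ![0, 0]) + μ (![0, 1], ![0, 1]) + μ (![0, 1], ![1, 0]) ≤ 0 := by linarith
  have lh' : μ (![0, 0], ![0, 1]) + μ (![0, 1], ![0, 1]) + μ (![1, 0], ![0, 1]) ≤ 0 := by linarith
  -- Moving from `![1, 0]` to `![0, 0]` loses only against `![0, 1]`, now excluded by `lh'`.
  have hl : μ (![1, 0], ![0, 0]) + μ (![1, 0], ![1, 0]) ≤ 0 := by linarith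
  have hl' : μ (![0, 0], ![1, 0]) + μ (![1, 0], ![1, 0]) ≤ 0 := by linarith
  linarith

theorem airline_sharp_isCorrelatedEq_iff
    (μ : stdSimplex ℝ ((Signal → Face) × (Signal → Face))) :
    (airline 1 50 20 60).sharp.IsCorrelatedEq μ ↔
      μ = stdSimplex.vertex (alwaysLow, alwaysLow) := by
  refine ⟨correlatedEq_eq_vertex, ?_⟩
  rintro rfl
  exact TwoPlayerGame.isCorrelatedEq_vertex airline_sharp_isNash

theorem airline_sharp_expPayoff :
    (airline 1 50 20 60).sharp.expPayoff (stdSimplex.vertex (alwaysLow, alwaysLow)) =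
      (15.25, 15.25) := by
  rw [TwoPlayerGame.expPayoff, TwoPlayerGame.sum_vertex_mul (alwaysLow, alwaysLow)
      (fun x => (airline 1 50 20 60).sharp.P₁ x.1 x.2),
    TwoPlayerGame.sum_vertex_mul (alwaysLow, alwaysLow)
      (fun x => (airline 1 50 20 60).sharp.P₂ x.1 x.2)]
  simp only [airline_sharp_P₂, airline_sharp_P₁_alwaysLow]

theorem airline_sharp_mixed_isNash_iff (σ τ : stdSimplex ℝ (Signal → Face)) :
    (airline 1 50 20 60).sharp.mixed.IsNash σ τ ↔
      σ = stdSimplex.vertex alwaysLow ∧ τ = stdSimplex.vertex alwaysLow := by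
  constructor
  · intro h
    have e := correlatedEq_eq_vertex h.isCorrelatedEq_independent
    have e' : σ alwaysLow * τ alwaysLow = 1 := by
      have := congrArg (fun μ : stdSimplex ℝ ((Signal → Face) × (Signal → Face)) =>
        μ (alwaysLow, alwaysLow)) e
      simpa [stdSimplex.vertex] using this
    have le : ∀ ρ : stdSimplex ℝ (Signal → Face), ρ alwaysLow ≤ 1 := fun ρ =>
      (Finset.single_le_sum (fun i _ => ρ.2.1 i) (Finset.mem_univ alwaysLow)).trans_eq ρ.2.2
    have hσ := le σ
    have hτ := le τ
    have hσ₀ : 0 ≤ σ alwaysLow := σ.2.1 _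
    have hτ₀ : 0 ≤ τ alwaysLow := τ.2.1 _
    exact ⟨eq_vertex_of_apply_eq_one (by nlinarith), eq_vertex_of_apply_eq_one (by nlinarith)⟩
  · rintro ⟨rfl, rfl⟩
    exact TwoPlayerGame.mixed_isNash_vertex airline_sharp_isNash

theorem airline_sharp_mixed_payoff :
    (airline 1 50 20 60).sharp.mixed.payoff (stdSimplex.vertex alwaysLow)
      (stdSimplex.vertex alwaysLow) = (15.25, 15.25) := by
  simp only [TwoPlayerGame.payoff, TwoPlayerGame.mixed_P₁_eq, TwoPlayerGame.mixed_P₂_eq,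
    TwoPlayerGame.sum_vertex_mul, airline_sharp_P₂, airline_sharp_P₁_alwaysLow]

/-! Behavioral strategies. -/

/-- Grouped so that the coefficients of `p 0 0` and `p 1 0` are, up to the factor 4, the gains from
shifting probability to the low price after `N` and after `P`. -/
theorem airline_mixed_sharp_P₁ (p q : Signal → stdSimplex ℝ Face) :
    (airline 1 50 20 60).mixed.sharp.P₁ p q =
      (p 0 0 * (40 - 49 * q 0 0 + 30 * q 1 0) + p 1 0 * (30 * q 0 0 + 30 * q 1 0 - 20)
        + 180 - 120 * q 1 0 - 60 * q 0 0) / 4 := by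
  have h : ∀ ρ : stdSimplex ℝ Face, ρ 1 = 1 - ρ 0 := fun ρ => by
    have : ∑ i, ρ i = 1 := ρ.2.2
    rw [Fin.sum_univ_two] at this
    linarith
  simp [PrivateInfoGame.sharp, PrivateInfoGame.mixed, airline, Fin.sum_univ_two,
    fairSignals_apply, h]
  ring

theorem airline_mixed_sharp_P₂ (p q : Signal → stdSimplex ℝ Face) :
    (airline 1 50 20 60).mixed.sharp.P₂ p q = (airline 1 50 20 60).mixed.sharp.P₁ q p := by
  simp [PrivateInfoGame.sharp, PrivateInfoGame.mixed, airline, Fin.sum_univ_two,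
    fairSignals_apply]
  ring

theorem alwaysLowBehavioral_apply (a : Signal) : alwaysLowBehavioral a 0 = 1 := by
  simp [alwaysLowBehavioral, low, stdSimplex.vertex]

theorem eq_alwaysLowBehavioral {p : Signal → stdSimplex ℝ Face} (h₀ : p 0 0 = 1)
    (h₁ : p 1 0 = 1) : p = alwaysLowBehavioral := by
  funext a
  fin_cases a
  · exact eq_vertex_of_apply_eq_one h₀
  · exact eq_vertex_of_apply_eq_one h₁

theorem stdSimplex_face_mem (p : stdSimplex ℝ Face) : 0 ≤ p 0 ∧ p 0 ≤ 1 :=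
  ⟨p.2.1 0, (Finset.single_le_sum (fun i _ => p.2.1 i) (Finset.mem_univ 0)).trans_eq p.2.2⟩

/-- The two one-signal deviations to the low price in the behavioral game. -/
theorem behavioral_gain_le {p q : Signal → stdSimplex ℝ Face}
    (h : ∀ p', (airline 1 50 20 60).mixed.sharp.P₁ p' q ≤
      (airline 1 50 20 60).mixed.sharp.P₁ p q) :
    (1 - p 0 0) * (40 - 49 * q 0 0 + 30 * q 1 0) ≤ 0 ∧
      (1 - p 1 0) * (30 * q 0 0 + 30 * q 1 0 - 20) ≤ 0 := by
  have e : (stdSimplex.vertex 0 : stdSimplex ℝ Face) 0 = 1 := by simp [stdSimplex.vertex]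
  have h₀ := h ![stdSimplex.vertex 0, p 1]
  have h₁ := h ![p 0, stdSimplex.vertex 0]
  simp only [airline_mixed_sharp_P₁, Matrix.cons_val_zero, Matrix.cons_val_one, e] at h₀ h₁
  constructor <;> linarith

/-- If `n < 1`, then `h₁` forces `n' ≥ 40/49 > 2/3`, so `h₂` gives `p = 1`, and then `h₃` gives `p'
= 1`. Now the gain in `h₁` is `70 - 49 n' > 0`, a contradiction. -/
theorem behavioral_solution {n p n' p' : ℝ} (hn : 0 ≤ n ∧ n ≤ 1) (hp : 0 ≤ p ∧ p ≤ 1)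
    (hn' : 0 ≤ n' ∧ n' ≤ 1) (hp' : 0 ≤ p' ∧ p' ≤ 1)
    (h₁ : (1 - n) * (40 - 49 * n' + 30 * p') ≤ 0) (h₂ : (1 - p) * (30 * n' + 30 * p' - 20) ≤ 0)
    (h₃ : (1 - p') * (30 * n + 30 * p - 20) ≤ 0) : n = 1 := by
  obtain ⟨hn0, hn1⟩ := hn
  obtain ⟨hp0, hp1⟩ := hp
  obtain ⟨hn'0, hn'1⟩ := hn'
  obtain ⟨hp'0, hp'1⟩ := hp'
  by_contra hne
  have hlt : 0 < 1 - n := by have := lt_of_le_of_ne hn1 hne; linarith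
  have k₁ := nonpos_of_mul_nonpos_right h₁ hlt
  have ep : p = 1 := by
    have := nonpos_of_mul_nonpos_left h₂ (by linarith)
    linarith
  have ep' : p' = 1 := by
    have := nonpos_of_mul_nonpos_left h₃ (by linarith)
    linarith
  linarith

theorem airline_mixed_sharp_isNash_iff (p q : Signal → stdSimplex ℝ Face) :
    (airline 1 50 20 60).mixed.sharp.IsNash p q ↔
      p = alwaysLowBehavioral ∧ q = alwaysLowBehavioral := by
  constructor
  · rintro ⟨hp, hq⟩
    simp only [airline_mixed_sharp_P₂] at hq
    obtain ⟨h₁, h₂⟩ := behavioral_gain_le hp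
    obtain ⟨h₃, h₄⟩ := behavioral_gain_le hq
    have m := fun a => stdSimplex_face_mem (p a)
    have m' := fun a => stdSimplex_face_mem (q a)
    have e := behavioral_solution (m 0) (m 1) (m' 0) (m' 1) h₁ h₂ h₄
    have e' := behavioral_solution (m' 0) (m' 1) (m 0) (m 1) h₃ h₄ h₂
    rw [e'] at h₂
    rw [e] at h₄
    have k := nonpos_of_mul_nonpos_left h₂ (by linarith [(m' 1).1])
    have k' := nonpos_of_mul_nonpos_left h₄ (by linarith [(m 1).1])
    exact ⟨eq_alwaysLowBehavioral e (by linarith [(m 1).2]),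
      eq_alwaysLowBehavioral e' (by linarith [(m' 1).2])⟩
  · rintro ⟨rfl, rfl⟩
    have h : ∀ p, (airline 1 50 20 60).mixed.sharp.P₁ p alwaysLowBehavioral ≤
        (airline 1 50 20 60).mixed.sharp.P₁ alwaysLowBehavioral alwaysLowBehavioral := by
      intro p
      simp only [airline_mixed_sharp_P₁, alwaysLowBehavioral_apply]
      linarith [(stdSimplex_face_mem (p 0)).2, (stdSimplex_face_mem (p 1)).2]
    exact ⟨h, fun q => by simpa only [airline_mixed_sharp_P₂] using h q⟩

theorem airline_mixed_sharp_payoff :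
    (airline 1 50 20 60).mixed.sharp.payoff alwaysLowBehavioral alwaysLowBehavioral =
      (15.25, 15.25) := by
  simp only [TwoPlayerGame.payoff, airline_mixed_sharp_P₂, airline_mixed_sharp_P₁,
    alwaysLowBehavioral_apply]
  norm_num

open Matrix

/-! Quantum strategies in the environment `HH + TT`. -/

/-- Read as a matrix, `HH + TT` is the identity, and `U ⊗ V` sends a matrix `X` to `U X Vᵀ`. -/
theorem evolve_maximallyEntangled (U V : Matrix Face Face ℂ) (i j : Face) :
    evolve maximallyEntangled.1 U V (i, j) = (U * Vᵀ) i j := by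
  simp [evolve, maximallyEntangled, mulVec, dotProduct, Fintype.sum_prod_type,
    Fin.sum_univ_two, Matrix.mul_apply, kroneckerMap_apply]

theorem unitary_row_normSq {W : Matrix Face Face ℂ} (hW : W ∈ unitaryGroup Face ℂ) (i : Face) :
    ‖W i 0‖ ^ 2 + ‖W i 1‖ ^ 2 = 1 := by
  have h := congrFun (congrFun (mem_unitaryGroup_iff.1 hW) i) i
  simp only [mul_apply, Fin.sum_univ_two, star_apply, one_apply_eq, RCLike.star_def,
    Complex.mul_conj'] at h
  exact_mod_cast h

theorem unitary_col_normSq {W : Matrix Face Face ℂ} (hW : W ∈ unitaryGroup Face ℂ) (j : Face) :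
    ‖W 0 j‖ ^ 2 + ‖W 1 j‖ ^ 2 = 1 := by
  have h := congrFun (congrFun (mem_unitaryGroup_iff'.1 hW) j) j
  simp only [mul_apply, Fin.sum_univ_two, star_apply, one_apply_eq, RCLike.star_def,
    Complex.conj_mul'] at h
  exact_mod_cast h

theorem transpose_mem_unitaryGroup {V : Matrix Face Face ℂ} (hV : V ∈ unitaryGroup Face ℂ) :
    Vᵀ ∈ unitaryGroup Face ℂ := by
  rw [mem_unitaryGroup_iff]
  have h := congrArg transpose (mem_unitaryGroup_iff'.1 hV)
  rw [transpose_mul, transpose_one] at h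
  exact h

/-- Twice the probability of observing `HH` when the players apply `U` and `V`. -/
noncomputable def agreement (U V : unitaryGroup Face ℂ) : ℝ := ‖(U.1 * V.1ᵀ) 0 0‖ ^ 2

/-- The squared moduli of a 2×2 unitary matrix are doubly stochastic, hence fixed by one entry;
their total is 2. -/
theorem observe_evolve (U V : unitaryGroup Face ℂ) (i j : Face) :
    observe (evolve maximallyEntangled.1 U.1 V.1) (i, j) =
      !![agreement U V / 2, (1 - agreement U V) / 2;
        (1 - agreement U V) / 2, agreement U V / 2] i j := by
  have hW : U.1 * V.1ᵀ ∈ unitaryGroup Face ℂ :=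
    mul_mem U.2 (transpose_mem_unitaryGroup V.2)
  have r₀ := unitary_row_normSq hW 0
  have r₁ := unitary_row_normSq hW 1
  have c₀ := unitary_col_normSq hW 0
  have e₀₁ : ‖(U.1 * V.1ᵀ) 0 1‖ ^ 2 = 1 - agreement U V := by rw [agreement]; linarith
  have e₁₀ : ‖(U.1 * V.1ᵀ) 1 0‖ ^ 2 = 1 - agreement U V := by rw [agreement]; linarith
  have e₁₁ : ‖(U.1 * V.1ᵀ) 1 1‖ ^ 2 = agreement U V := by rw [agreement]; linarith
  have e₀₀ : ‖(U.1 * V.1ᵀ) 0 0‖ ^ 2 = agreement U V := rfl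
  have hs : ∑ y, ‖evolve maximallyEntangled.1 U.1 V.1 y‖ ^ 2 = 2 := by
    simp only [Fintype.sum_prod_type, Fin.sum_univ_two, evolve_maximallyEntangled]
    linarith
  rw [observe, hs, evolve_maximallyEntangled]
  fin_cases i <;> fin_cases j <;> simp [e₀₀, e₀₁, e₁₀, e₁₁]

theorem observe_evolve_one_right (U : unitaryGroup Face ℂ) (i : Face) :
    ∑ j, observe (evolve maximallyEntangled.1 U.1 1) (i, j) = 1 / 2 := by
  have h := observe_evolve U 1
  simp only [OneMemClass.coe_one] at h
  simp only [h, Fin.sum_univ_two]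
  fin_cases i <;> simp <;> ring

theorem observe_evolve_one_left (V : unitaryGroup Face ℂ) (j : Face) :
    ∑ i, observe (evolve maximallyEntangled.1 1 V.1) (i, j) = 1 / 2 := by
  have h := observe_evolve 1 V
  simp only [OneMemClass.coe_one] at h
  simp only [h, Fin.sum_univ_two]
  fin_cases j <;> simp <;> ring

/-! Payoffs in the quantum airline game. -/

/-- The common payoff of the firms if they play unitaries with the given agreement. -/
noncomputable def agreementPayoff (a b : Signal) (x : ℝ) : ℝ :=
  if a = 0 ∧ b = 0 then 25 - 49 / 2 * x else 25 + 15 * x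

theorem airline_P₁ (A B C D : ℝ) (a b : Signal) (i j : Face) :
    (airline A B C D).P₁ a b i j =
      !![if a = 0 ∧ b = 0 then A else C, B; 0, if a = 0 ∧ b = 0 then 0 else D] i j := by
  fin_cases a <;> fin_cases b <;> rfl

theorem airline_P₂ (A B C D : ℝ) (a b : Signal) (i j : Face) :
    (airline A B C D).P₂ a b i j =
      !![if a = 0 ∧ b = 0 then A else C, 0; B, if a = 0 ∧ b = 0 then 0 else D] i j := by
  fin_cases a <;> fin_cases b <;> rfl

theorem quantum_P₁_unitary (a b : Signal) (U V : unitaryGroup Face ℂ) :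
    ((airline 1 50 20 60).quantum maximallyEntangled).P₁ a b (.unitary U) (.unitary V) =
      agreementPayoff a b (agreement U V) := by
  simp only [PrivateInfoGame.quantum, playLaw, Fintype.sum_prod_type, Fin.sum_univ_two,
    observe_evolve, airline_P₁, agreementPayoff, of_apply, cons_val_zero, cons_val_one]
  split_ifs <;> ring

theorem quantum_P₂_unitary (a b : Signal) (U V : unitaryGroup Face ℂ) :
    ((airline 1 50 20 60).quantum maximallyEntangled).P₂ a b (.unitary U) (.unitary V) =
      agreementPayoff a b (agreement U V) := by
  simp only [PrivateInfoGame.quantum, playLaw, Fintype.sum_prod_type, Fin.sum_univ_two,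
    observe_evolve, airline_P₂, agreementPayoff, of_apply, cons_val_zero, cons_val_one]
  split_ifs <;> ring

/-- The payoff of a firm that discards its coin, against a firm that plays a unitary. -/
noncomputable def discardPayoff (a b : Signal) (s : Face) : ℝ :=
  if a = 0 ∧ b = 0 then ![51 / 2, 0] s else ![35, 30] s

theorem quantum_P₁_pure (a b : Signal) (s : Face) (V : unitaryGroup Face ℂ) :
    ((airline 1 50 20 60).quantum maximallyEntangled).P₁ a b (.pure s) (.unitary V) =
      discardPayoff a b s := by
  simp only [PrivateInfoGame.quantum, playLaw, observe_evolve_one_left]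
  revert s
  rw [Fin.forall_fin_two]
  simp only [Fintype.sum_prod_type, Fin.sum_univ_two, airline_P₁, discardPayoff, zero_ne_one,
    one_ne_zero, if_true, if_false]
  split_ifs <;> norm_num

theorem quantum_P₂_pure (a b : Signal) (s : Face) (U : unitaryGroup Face ℂ) :
    ((airline 1 50 20 60).quantum maximallyEntangled).P₂ a b (.unitary U) (.pure s) =
      discardPayoff a b s := by
  simp only [PrivateInfoGame.quantum, playLaw, observe_evolve_one_right]
  revert s
  rw [Fin.forall_fin_two]
  simp only [Fintype.sum_prod_type, Fin.sum_univ_two, airline_P₂, discardPayoff, zero_ne_one,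
    one_ne_zero, if_true, if_false]
  split_ifs <;> norm_num

/-- The common payoff in the game without pure strategies. -/
noncomputable def commonPayoff (U V : Signal → unitaryGroup Face ℂ) : ℝ :=
  (100 - 49 / 2 * agreement (U 0) (V 0) + 15 * agreement (U 0) (V 1)
    + 15 * agreement (U 1) (V 0) + 15 * agreement (U 1) (V 1)) / 4

theorem quantum_ν_apply (A B C D : ℝ) (ξ : Environment) (x : Signal × Signal) :
    ((airline A B C D).quantum ξ).ν x = 1 / 4 := rfl

theorem quantum_sharp_P₁_unitary (U V : Signal → unitaryGroup Face ℂ) :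
    ((airline 1 50 20 60).quantum maximallyEntangled).sharp.P₁ (fun a => .unitary (U a))
      (fun b => .unitary (V b)) = commonPayoff U V := by
  simp [PrivateInfoGame.sharp, quantum_P₁_unitary, Fin.sum_univ_two, commonPayoff,
    agreementPayoff, quantum_ν_apply]
  ring

theorem quantumOnly_sharp_P₁ (U V : Signal → unitaryGroup Face ℂ) :
    ((airline 1 50 20 60).quantumOnly maximallyEntangled).sharp.P₁ U V = commonPayoff U V :=
  quantum_sharp_P₁_unitary U V

theorem quantum_sharp_P₂_unitary (U V : Signal → unitaryGroup Face ℂ) :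
    ((airline 1 50 20 60).quantum maximallyEntangled).sharp.P₂ (fun a => .unitary (U a))
      (fun b => .unitary (V b)) = commonPayoff U V := by
  simp [PrivateInfoGame.sharp, quantum_P₂_unitary, Fin.sum_univ_two, commonPayoff,
    agreementPayoff, quantum_ν_apply]
  ring

theorem quantumOnly_sharp_P₂ (U V : Signal → unitaryGroup Face ℂ) :
    ((airline 1 50 20 60).quantumOnly maximallyEntangled).sharp.P₂ U V = commonPayoff U V :=
  quantum_sharp_P₂_unitary U V

/-! The maximal common payoff. -/

/-- The Bloch vector of a vector of `ℂ²`. -/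
noncomputable def bloch (p q : ℂ) : Fin 3 → ℝ :=
  ![Complex.normSq p - Complex.normSq q, 2 * (p.re * q.re + p.im * q.im),
    2 * (p.re * q.im - p.im * q.re)]

/-- The Bloch vector of the complex conjugate of a vector of `ℂ²`. -/
noncomputable def blochConj (p q : ℂ) : Fin 3 → ℝ :=
  ![Complex.normSq p - Complex.normSq q, 2 * (p.re * q.re + p.im * q.im),
    -(2 * (p.re * q.im - p.im * q.re))]

theorem bloch_dotProduct_self (p q : ℂ) :
    bloch p q ⬝ᵥ bloch p q = (Complex.normSq p + Complex.normSq q) ^ 2 := by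
  simp [bloch, dotProduct, Fin.sum_univ_three, Complex.normSq_apply]
  ring

theorem blochConj_dotProduct_self (p q : ℂ) :
    blochConj p q ⬝ᵥ blochConj p q = (Complex.normSq p + Complex.normSq q) ^ 2 := by
  simp [blochConj, dotProduct, Fin.sum_univ_three, Complex.normSq_apply]
  ring

/-- The overlap of two vectors of `ℂ²` in terms of Bloch vectors. The bilinear `p r + q s` is the
Hermitian product with the conjugate of `(r, s)`, hence `blochConj`. -/
theorem normSq_mul_add_mul (p q r s : ℂ) :
    2 * Complex.normSq (p * r + q * s) =
      (Complex.normSq p + Complex.normSq q) * (Complex.normSq r + Complex.normSq s)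
        + bloch p q ⬝ᵥ blochConj r s := by
  simp [bloch, blochConj, dotProduct, Fin.sum_univ_three, Complex.normSq_apply]
  ring

/-- The Bloch vectors attached to the first rows of the two unitaries. -/
theorem exists_bloch (U V : Signal → unitaryGroup Face ℂ) :
    ∃ a b : Signal → Fin 3 → ℝ, (∀ i, a i ⬝ᵥ a i = 1) ∧ (∀ j, b j ⬝ᵥ b j = 1) ∧
      ∀ i j, agreement (U i) (V j) = (1 + a i ⬝ᵥ b j) / 2 := by
  have h : ∀ W : unitaryGroup Face ℂ,
      Complex.normSq (W.1 0 0) + Complex.normSq (W.1 0 1) = 1 := fun W => by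
    simpa only [Complex.normSq_eq_norm_sq] using unitary_row_normSq W.2 0
  refine ⟨fun i => bloch ((U i).1 0 0) ((U i).1 0 1),
    fun j => blochConj ((V j).1 0 0) ((V j).1 0 1), fun i => ?_, fun j => ?_, fun i j => ?_⟩
  · rw [bloch_dotProduct_self, h, one_pow]
  · rw [blochConj_dotProduct_self, h, one_pow]
  · have e := normSq_mul_add_mul ((U i).1 0 0) ((U i).1 0 1) ((V j).1 0 0) ((V j).1 0 1)
    rw [h, h] at e
    simp only [agreement, mul_apply, Fin.sum_univ_two, transpose_apply,
      ← Complex.normSq_eq_norm_sq]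
    linarith

/-- A weighted Tsirelson bound for unit vectors. -/
theorem weighted_tsirelson {a₁ a₂ b₁ b₂ : Fin 3 → ℝ} (ha₁ : a₁ ⬝ᵥ a₁ = 1) (ha₂ : a₂ ⬝ᵥ a₂ = 1)
    (hb₁ : b₁ ⬝ᵥ b₁ = 1) (hb₂ : b₂ ⬝ᵥ b₂ = 1) :
    -(49 / 2) * (a₁ ⬝ᵥ b₁) + 15 * (a₁ ⬝ᵥ b₂ + a₂ ⬝ᵥ b₁ + a₂ ⬝ᵥ b₂) ≤ 79 * √79 / 14 := by
  have hr : √79 ^ 2 = (79 : ℝ) := Real.sq_sqrt (by norm_num)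
  have hp : 0 < √79 := by positivity
  set r := √79
  -- For fixed `b₁, b₂` the best `a₁, a₂` point along `-(49/2) b₁ + 15 b₂` and `b₁ + b₂`. The sum of
  -- `|-(49/2) b₁ + 15 b₂|` and `15 |b₁ + b₂|` is largest at `b₁ ⬝ b₂ = -19/98`, where the two
  -- vectors have lengths `7√79/2` and `√79/7`. Both squares vanish there, and the weights `1/7` and
  -- `105/2` below cancel the `b₁ ⬝ b₂` terms.
  have k₁ : 0 ≤ (r • (7 / 2 : ℝ) • a₁ + (49 / 2 : ℝ) • b₁ - (15 : ℝ) • b₂) ⬝ᵥ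
      (r • (7 / 2 : ℝ) • a₁ + (49 / 2 : ℝ) • b₁ - (15 : ℝ) • b₂) :=
    Finset.sum_nonneg fun i _ => mul_self_nonneg _
  have k₂ : 0 ≤ (r • (1 / 7 : ℝ) • a₂ - b₁ - b₂) ⬝ᵥ (r • (1 / 7 : ℝ) • a₂ - b₁ - b₂) :=
    Finset.sum_nonneg fun i _ => mul_self_nonneg _
  refine le_of_mul_le_mul_left ?_ hp
  simp only [dotProduct, Fin.sum_univ_three, Pi.add_apply, Pi.sub_apply, Pi.smul_apply,
    smul_eq_mul] at *
  linear_combination (1 / 7 : ℝ) * k₁ + (105 / 2 : ℝ) * k₂ + (7 / 4 * r ^ 2) * ha₁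
    + (15 / 14 * r ^ 2) * ha₂ + (553 / 4 : ℝ) * hb₁ + (225 / 7 + 105 / 2 : ℝ) * hb₂
    - (79 / 28 : ℝ) * hr

theorem commonPayoff_le (U V : Signal → unitaryGroup Face ℂ) :
    commonPayoff U V ≤ (3087 + 79 * √79) / 112 := by
  obtain ⟨a, b, ha, hb, h⟩ := exists_bloch U V
  have := weighted_tsirelson (ha 0) (ha 1) (hb 0) (hb 1)
  simp only [commonPayoff, h]
  linarith
/-! The rotation profiles. -/

theorem agreement_rotation (α β : ℝ) :
    agreement (rotation α) (rotation β) = Real.cos (α - β) ^ 2 := by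
  have h : ((rotation α).1 * (rotation β).1ᵀ) 0 0 = ((Real.cos (α - β) : ℝ) : ℂ) := by
    rw [Real.cos_sub]
    simp [rotation, mul_apply, Fin.sum_univ_two]
  rw [agreement, h, Complex.norm_real, Real.norm_eq_abs, sq_abs]

/-- The angle difference is `-3θ` when both signals are `N` and `±θ` otherwise: the firms disagree
often exactly where agreement is costly. -/
theorem commonPayoff_rotation (θ : ℝ) :
    commonPayoff (rotation₁ θ) (rotation₂ θ) =
      (100 - 49 / 2 * Real.cos (3 * θ) ^ 2 + 45 * Real.cos θ ^ 2) / 4 := by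
  have e₁ : -θ - 2 * θ = -(3 * θ) := by ring
  have e₂ : θ - 2 * θ = -θ := by ring
  simp only [commonPayoff, rotation₁, rotation₂, cons_val_zero, cons_val_one, agreement_rotation,
    e₁, e₂, sub_zero, Real.cos_neg]
  ring

/-- The angle of the quantum equilibrium. -/
noncomputable def optimalAngle : ℝ := Real.arccos (1 / 2 * √((14 + √79) / 7))

theorem cos_sq_optimalAngle : Real.cos optimalAngle ^ 2 = (14 + √79) / 28 := by
  have h₀ : 0 ≤ (14 + √79) / 7 := by positivity
  have h₁ : √79 ≤ 9 := Real.sqrt_le_iff.2 ⟨by norm_num, by norm_num⟩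
  have h₂ : √((14 + √79) / 7) ≤ 2 := Real.sqrt_le_iff.2 ⟨by norm_num, by linarith⟩
  have h₃ := Real.sqrt_nonneg ((14 + √79) / 7)
  rw [optimalAngle, Real.cos_arccos (by linarith) (by linarith), mul_pow, Real.sq_sqrt h₀]
  ring

theorem cos_sq_three_mul_optimalAngle :
    Real.cos (3 * optimalAngle) ^ 2 = 1 / 2 - 17 * √79 / 343 := by
  have hr : √79 ^ 2 = (79 : ℝ) := Real.sq_sqrt (by norm_num)
  have h : Real.cos (3 * optimalAngle) ^ 2 =
      Real.cos optimalAngle ^ 2 * (4 * Real.cos optimalAngle ^ 2 - 3) ^ 2 := by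
    rw [Real.cos_three_mul]
    ring
  rw [h, cos_sq_optimalAngle]
  linear_combination (√79 / 1372) * hr

theorem commonPayoff_optimalAngle :
    commonPayoff (rotation₁ optimalAngle) (rotation₂ optimalAngle) =
      (3087 + 79 * √79) / 112 := by
  rw [commonPayoff_rotation, cos_sq_optimalAngle, cos_sq_three_mul_optimalAngle]
  ring

theorem commonPayoff_le_optimal (U V : Signal → unitaryGroup Face ℂ) :
    commonPayoff U V ≤ commonPayoff (rotation₁ optimalAngle) (rotation₂ optimalAngle) :=
  (commonPayoff_le U V).trans_eq commonPayoff_optimalAngle.symm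

theorem quantumOnly_isNash :
    ((airline 1 50 20 60).quantumOnly maximallyEntangled).sharp.IsNash
      (rotation₁ optimalAngle) (rotation₂ optimalAngle) := by
  constructor <;> intro <;> simp only [quantumOnly_sharp_P₁, quantumOnly_sharp_P₂] <;>
    exact commonPayoff_le_optimal _ _

theorem quantumOnly_isParetoOptimal :
    ((airline 1 50 20 60).quantumOnly maximallyEntangled).sharp.IsParetoOptimal
      (rotation₁ optimalAngle) (rotation₂ optimalAngle) := by
  rintro ⟨U, V, -, -, h⟩
  simp only [TwoPlayerGame.payoff, quantumOnly_sharp_P₁, quantumOnly_sharp_P₂, or_self] at h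
  exact absurd (commonPayoff_le_optimal U V) (not_le.2 h)

theorem sqrt_79_bounds : 8.888 < √79 ∧ √79 < 8.8883 :=
  ⟨Real.lt_sqrt_of_sq_lt (by norm_num), (Real.sqrt_lt' (by norm_num)).2 (by norm_num)⟩

/-! Deviations in the full quantum game. -/

theorem agreementPayoff_optimal (a b : Signal) :
    agreementPayoff a b (agreement (rotation₁ optimalAngle a) (rotation₂ optimalAngle b)) =
      if a = 0 ∧ b = 0 then 51 / 4 + 17 * √79 / 14 else 65 / 2 + 15 * √79 / 28 := by
  have e₁ : -optimalAngle - 2 * optimalAngle = -(3 * optimalAngle) := by ring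
  have e₂ : optimalAngle - 2 * optimalAngle = -optimalAngle := by ring
  have h₁ := cos_sq_optimalAngle
  have h₃ := cos_sq_three_mul_optimalAngle
  fin_cases a <;> fin_cases b <;>
    simp [agreementPayoff, agreement_rotation, rotation₁, rotation₂, e₁, e₂, h₁, h₃] <;> ring

/-- The closest case is the low price after `N`: it earns `60.5` against `181/4 + 7√79/4 ≈ 60.80`.
-/
theorem sum_discardPayoff_le (a : Signal) (s : Face) :
    ∑ b, discardPayoff a b s ≤ ∑ b, agreementPayoff a b
      (agreement (rotation₁ optimalAngle a) (rotation₂ optimalAngle b)) := by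
  have := sqrt_79_bounds.1
  simp only [agreementPayoff_optimal, Fin.sum_univ_two, discardPayoff]
  fin_cases a <;> fin_cases s <;> norm_num <;> linarith

theorem sum_discardPayoff_le' (b : Signal) (s : Face) :
    ∑ a, discardPayoff a b s ≤ ∑ a, agreementPayoff a b
      (agreement (rotation₁ optimalAngle a) (rotation₂ optimalAngle b)) := by
  have := sqrt_79_bounds.1
  simp only [agreementPayoff_optimal, Fin.sum_univ_two, discardPayoff]
  fin_cases b <;> fin_cases s <;> norm_num <;> linarith

theorem commonPayoff_eq_sum (U V : Signal → unitaryGroup Face ℂ) :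
    commonPayoff U V = (∑ a, ∑ b, agreementPayoff a b (agreement (U a) (V b))) / 4 := by
  simp [commonPayoff, agreementPayoff, Fin.sum_univ_two]
  ring

theorem sum_agreementPayoff_le (a : Signal) (U : unitaryGroup Face ℂ) :
    ∑ b, agreementPayoff a b (agreement U (rotation₂ optimalAngle b)) ≤
      ∑ b, agreementPayoff a b
        (agreement (rotation₁ optimalAngle a) (rotation₂ optimalAngle b)) := by
  -- Changing the unitary after one signal leaves the terms of the other signal unchanged, so global
  -- optimality localizes.
  have h := commonPayoff_le_optimal (Function.update (rotation₁ optimalAngle) a U)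
    (rotation₂ optimalAngle)
  simp only [commonPayoff_eq_sum, Fin.sum_univ_two (fun a => ∑ b, agreementPayoff a b _)] at h
  fin_cases a <;> simp [Function.update] at h ⊢ <;> linarith

theorem sum_agreementPayoff_le' (b : Signal) (V : unitaryGroup Face ℂ) :
    ∑ a, agreementPayoff a b (agreement (rotation₁ optimalAngle a) V) ≤
      ∑ a, agreementPayoff a b
        (agreement (rotation₁ optimalAngle a) (rotation₂ optimalAngle b)) := by
  have h := commonPayoff_le_optimal (rotation₁ optimalAngle)
    (Function.update (rotation₂ optimalAngle) b V)
  simp only [commonPayoff_eq_sum] at h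
  fin_cases b <;> simp [Function.update] at h ⊢ <;> linarith

/-- A deviation may mix kinds, a unitary after one signal and a pure price after the other. As
payoffs are sums over the deviator's own signal, each signal can be treated alone. -/
theorem quantum_isNash :
    ((airline 1 50 20 60).quantum maximallyEntangled).sharp.IsNash
      (fun a => .unitary (rotation₁ optimalAngle a))
      (fun b => .unitary (rotation₂ optimalAngle b)) := by
  constructor
  · intro X
    simp only [PrivateInfoGame.sharp, quantum_ν_apply, ← Finset.mul_sum]
    refine mul_le_mul_of_nonneg_left (Finset.sum_le_sum fun a _ => ?_) (by norm_num)
    simp only [quantum_P₁_unitary]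
    cases X a with
    | unitary U => simpa only [quantum_P₁_unitary] using sum_agreementPayoff_le a U
    | pure s => simpa only [quantum_P₁_pure] using sum_discardPayoff_le a s
  · intro Y
    simp only [PrivateInfoGame.sharp, quantum_ν_apply, ← Finset.mul_sum]
    refine mul_le_mul_of_nonneg_left ?_ (by norm_num)
    refine Finset.sum_comm.trans_le
      (le_of_le_of_eq (Finset.sum_le_sum fun b _ => ?_) Finset.sum_comm)
    simp only [quantum_P₂_unitary]
    cases Y b with
    | unitary V => simpa only [quantum_P₂_unitary] using sum_agreementPayoff_le' b V
    | pure s => simpa only [quantum_P₂_pure] using sum_discardPayoff_le' b s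

theorem quantum_payoff :
    ((airline 1 50 20 60).quantum maximallyEntangled).sharp.payoff
      (fun a => .unitary (rotation₁ optimalAngle a))
      (fun b => .unitary (rotation₂ optimalAngle b)) =
      ((3087 + 79 * √79) / 112, (3087 + 79 * √79) / 112) := by
  simp only [TwoPlayerGame.payoff, quantum_sharp_P₁_unitary, quantum_sharp_P₂_unitary,
    commonPayoff_optimalAngle]

end QuantumGames
theorem mainTheorem4 (G : PrivateInfoGame Signal Signal Face Face) (hG : G = airline 1 50 20 60)
    (ξ : Environment) (hξ : ξ = maximallyEntangled)
    (θ : ℝ) (hθ : θ = Real.arccos (1 / 2 * √((14 + √79) / 7)))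
    (v : ℝ) (hv : v = (3087 + 79 * √79) / 112)
    (s₁ s₂ : Signal → QStrategy)
    (hs₁ : s₁ = fun a => QStrategy.unitary (rotation₁ θ a))
    (hs₂ : s₂ = fun b => QStrategy.unitary (rotation₂ θ b)) :
    -- the unique classical equilibrium, in behavioral strategies
    (∀ p q, G.mixed.sharp.IsNash p q ↔ p = alwaysLowBehavioral ∧ q = alwaysLowBehavioral) ∧
    G.mixed.sharp.payoff alwaysLowBehavioral alwaysLowBehavioral = (15.25, 15.25) ∧
    -- the unique classical equilibrium, in mixed strategies
    (∀ σ τ, G.sharp.mixed.IsNash σ τ ↔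
      σ = stdSimplex.vertex alwaysLow ∧ τ = stdSimplex.vertex alwaysLow) ∧
    G.sharp.mixed.payoff (stdSimplex.vertex alwaysLow) (stdSimplex.vertex alwaysLow) =
      (15.25, 15.25) ∧
    -- the unique correlated equilibrium
    (∀ μ, G.sharp.IsCorrelatedEq μ ↔ μ = stdSimplex.vertex (alwaysLow, alwaysLow)) ∧
    G.sharp.expPayoff (stdSimplex.vertex (alwaysLow, alwaysLow)) = (15.25, 15.25) ∧
    -- among the rotation profiles, this one maximizes both payoffs
    (∀ φ, (G.quantumOnly ξ).sharp.payoff (rotation₁ φ) (rotation₂ φ) ≤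
      (G.quantumOnly ξ).sharp.payoff (rotation₁ θ) (rotation₂ θ)) ∧
    -- it is a Pareto optimal equilibrium of the game without pure strategies
    (G.quantumOnly ξ).sharp.IsNash (rotation₁ θ) (rotation₂ θ) ∧
    (G.quantumOnly ξ).sharp.IsParetoOptimal (rotation₁ θ) (rotation₂ θ) ∧
    -- it is an equilibrium of the full quantum game, with the stated payoff
    (G.quantum ξ).sharp.IsNash s₁ s₂ ∧
    (G.quantum ξ).sharp.payoff s₁ s₂ = (v, v) ∧
    |v - 33.83| < 0.005 ∧
    -- it is Pareto superior to every correlated equilibrium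
    (∀ μ, G.sharp.IsCorrelatedEq μ →
      ParetoSuperior ((G.quantum ξ).sharp.payoff s₁ s₂) (G.sharp.expPayoff μ)) := by

  subst hG hξ hv hs₁ hs₂
  obtain rfl : θ = optimalAngle := hθ
  obtain ⟨hl, hu⟩ := sqrt_79_bounds
  refine ⟨airline_mixed_sharp_isNash_iff, airline_mixed_sharp_payoff,
    airline_sharp_mixed_isNash_iff, airline_sharp_mixed_payoff, airline_sharp_isCorrelatedEq_iff,
    airline_sharp_expPayoff, fun φ => ?_, quantumOnly_isNash, quantumOnly_isParetoOptimal,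
    quantum_isNash, quantum_payoff, ?_, fun μ hμ => ?_⟩
  · simp only [TwoPlayerGame.payoff, quantumOnly_sharp_P₁, quantumOnly_sharp_P₂, Prod.mk_le_mk,
      and_self]
    exact commonPayoff_le_optimal _ _
  · rw [abs_lt]
    constructor <;> linarith
  · rw [correlatedEq_eq_vertex hμ, airline_sharp_expPayoff, quantum_payoff]
    exact ⟨by norm_num; linarith, by norm_num; linarith, Or.inl (by norm_num; linarith)⟩
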